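/- Let $s$ and $k$ be positive integers. Let $P_n$ denote the path on $n$ vertices and $P_n^k$ its $k$-th power, i.e. the graph on $V(P_n)$ in which two distinct vertices are adjacent if and only if their distance in $P_n$ is at most $k$. For finite graphs $G$ and $H$, write $G\to(H)_s$ if every colouring of the edges of $G$ with $s$ colours contains a monochromatic copy of $H$ (a not necessarily induced subgraph isomorphic to $H$, all of whose edges have the same colour), and let $\hat r_s(H)=\min\{|E(G)| : G\to(H)_s\}$ be the $s$-colour size-Ramsey number of $H$. Then $$\hat r_s(P_n^k)=O(n)\qquad(n\to\infty),$$ where the implied constant may depend on $s$ and $k$. In other words, there is a constant $C=C(s,k)$ such that for every positive integer $n$ there is a finite graph $G$ with at most $Cn$ edges such that every $s$-colouring of the edges of $G$ contains a monochromatic copy of $P_n^k$. -/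

import Mathlib

namespace SizeRamsey

open SimpleGraph

/-- The `k`-th power `H^k` of a graph `H`: distinct vertices are adjacent iff their distance in `H`
is at most `k` (the extended distance, so that vertices in different components have distance `⊤`
and are never adjacent). -/
def graphPower {V : Type*} (H : SimpleGraph V) (k : ℕ) : SimpleGraph V where
  Adj u v := u ≠ v ∧ H.edist u v ≤ k
  symm := ⟨fun u v h => ⟨h.1.symm, by rw [SimpleGraph.edist_comm]; exact h.2⟩⟩
  loopless := ⟨fun _ h => h.1 rfl⟩

/-- The graph `P_n^k`, the `k`-th power of the path on `n` vertices. -/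
def pathPower (n k : ℕ) : SimpleGraph (Fin n) := graphPower (pathGraph n) k

/-- `G → (H)_s`: every colouring of the edges of `G` with `s` colours contains a monochromatic copy
of `H`, i.e. for some colour `c` the graph formed by the edges of colour `c` has a (not necessarily
induced) subgraph isomorphic to `H`. -/
def Arrows {V W : Type*} (G : SimpleGraph V) (H : SimpleGraph W) (s : ℕ) : Prop :=
  ∀ χ : G.EdgeLabeling (Fin s), ∃ c : Fin s, H.IsContained (χ.labelGraph c)

/-- The `s`-colour size-Ramsey number `min {|E(G)| : G → (H)_s}`, over all finite graphs `G`
(every finite graph is isomorphic to one with vertex set `Fin N`). -/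
noncomputable def sizeRamseyNumber {W : Type*} (s : ℕ) (H : SimpleGraph W) : ℕ :=
  sInf {m : ℕ | ∃ (N : ℕ) (G : SimpleGraph (Fin N)), Arrows G H s ∧ G.edgeSet.ncard = m}

end SizeRamsey

namespace SizeRamsey

open Finset
open scoped Classical

/-! The proof is by induction on the number of colours. The host graph is a blow-up: each point of a
bounded-degree relation `Γ` on linearly many points becomes a clique of bounded size `T`, so there
are linearly many edges. The inductive statement `BlowupArrows` also holds on any half of the
points, because the inductive step loses points.

For the step, let `Γ'` serve one colour fewer, let `G` be a bounded-degree expander, and let `Γ`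
relate `x` and `y` when they are `G`-out-neighbours of `Γ'`-related points. In a coloured blow-up of
`Γ`, Ramsey's theorem gives a monochromatic clique in every part, and some colour `c` is popular.
Link two parts if colour `c` contains a complete bipartite graph with sides `2 * k` between their
cliques. A long path of links yields the path power (`containsPathPower_of_chain`). Otherwise
depth-first search gives many linear-sized families of parts with no links between different
families (`exists_separated_family`).

Between unlinked cliques colour `c` has no large complete bipartite graph, so representatives can be
chosen in the cliques with no edge of colour `c` between related unlinked parts
(`exists_transversal`). By expansion, at least half of the points `w` have an out-neighbour in every
family. Sending the copies of `w` to representatives at these out-neighbours embeds the blow-up of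
`Γ'` on those points without using colour `c` (`exists_colour_reducing_map`), and induction applies.
-/

/-! ### Ramsey's theorem and greedy colouring. -/

/-- Multicolour Ramsey theorem with a separate target size for each colour. -/
theorem exists_monochromatic_of_sum_le (s M : ℕ) :
    ∃ T : ℕ, ∀ {α κ : Type} (C : Finset κ) (m : κ → ℕ), #C = s → ∑ c ∈ C, m c ≤ M →
      ∀ (U : Finset α) (χ : α → α → κ),
      (∀ x y, χ x y = χ y x) → (∀ x ∈ U, ∀ y ∈ U, x ≠ y → χ x y ∈ C) → T ≤ #U →
      ∃ c ∈ C, ∃ S ⊆ U, #S = m c ∧ ∀ x ∈ S, ∀ y ∈ S, x ≠ y → χ x y = c := by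
  induction M with
  | zero =>
    refine ⟨2, fun C m _ hm U χ _ hC hU => ?_⟩
    obtain ⟨x, hx, y, hy, hxy⟩ := one_lt_card.1 (by omega : 1 < #U)
    refine ⟨_, hC x hx y hy hxy, ∅, by simp, ?_, by simp⟩
    have := (Finset.sum_eq_zero_iff.1 (Nat.le_zero.1 hm)) _ (hC x hx y hy hxy)
    simp [this]
  | succ M ih =>
    obtain ⟨T, hT⟩ := ih
    -- The `+ 2` leaves a second vertex besides `x`, which makes `C` nonempty for the pigeonhole
    -- step.
    refine ⟨s * T + 2, fun C m hs hm U χ hχ hC hU => ?_⟩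
    obtain ⟨x, hx, y₀, hy₀, hxy₀⟩ := one_lt_card.1 (by omega : 1 < #U)
    have hcard : #(U.erase x) = #U - 1 := card_erase_of_mem hx
    obtain ⟨c, hc, hcT⟩ : ∃ c ∈ C, T ≤ #{y ∈ U.erase x | χ x y = c} := by
      refine exists_le_card_fiber_of_mul_le_card_of_maps_to
        (fun y hy => hC x hx y (mem_of_mem_erase hy) (ne_of_mem_erase hy).symm)
        ⟨_, hC x hx y₀ hy₀ hxy₀⟩ (by rw [hs]; omega)
    by_cases hmc : m c = 0
    · exact ⟨c, hc, ∅, by simp, by simp [hmc], by simp⟩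
    -- Inside the `c`-neighbourhood of `x` the target for `c` drops by one, since `x` can be added
    -- back.
    obtain ⟨c', hc', S, hS, hSm, hSχ⟩ := hT C (Function.update m c (m c - 1)) hs (by
        rw [sum_update_of_mem hc]
        have := add_sum_erase C m hc
        rw [sdiff_singleton_eq_erase]
        omega) {y ∈ U.erase x | χ x y = c} χ hχ
      (fun a ha b hb => hC a (mem_of_mem_erase (mem_filter.1 ha).1)
        b (mem_of_mem_erase (mem_filter.1 hb).1)) hcT
    have hSU : S ⊆ U := hS.trans ((filter_subset _ _).trans (erase_subset _ _))
    by_cases hcc : c' = c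
    · subst hcc
      have hxS : x ∉ S := fun h => by simpa using hS h
      refine ⟨c', hc, insert x S, insert_subset hx hSU, ?_, ?_⟩
      · rw [card_insert_of_notMem hxS, hSm, Function.update_self]
        omega
      · intro a ha b hb hab
        rcases mem_insert.1 ha with rfl | ha' <;> rcases mem_insert.1 hb with rfl | hb'
        · exact absurd rfl hab
        · exact (mem_filter.1 (hS hb')).2
        · rw [hχ]; exact (mem_filter.1 (hS ha')).2
        · exact hSχ a ha' b hb' hab
    · exact ⟨c', hc', S, hSU, by rw [hSm, Function.update_of_ne hcc], hSχ⟩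

/-- Greedy colouring of a symmetric relation of bounded degree. -/
theorem exists_proper_colouring {V : Type*} [Fintype V] (Γ : V → V → Prop) (d : ℕ)
    (hrefl : ∀ x, Γ x x) (hsymm : ∀ x y, Γ x y → Γ y x) (hd : ∀ x, #{y | Γ x y} ≤ d) :
    ∃ a : V → Fin d, ∀ x y, x ≠ y → Γ x y → a x ≠ a y := by
  have key : ∀ J : Finset V, ∃ a : V → Fin d, ∀ x ∈ J, ∀ y ∈ J, x ≠ y → Γ x y → a x ≠ a y := by
    intro J
    induction J using Finset.induction_on with
    | empty =>
      refine ⟨fun x => ⟨0, ?_⟩, by simp⟩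
      exact (card_pos.2 ⟨x, by simpa using hrefl x⟩).trans_le (hd x)
    | insert v J hv ih =>
      obtain ⟨a, ha⟩ := ih
      -- Reflexivity makes `v` one of its own at most `d` neighbours, so `d` colours suffice rather
      -- than `d + 1`.
      obtain ⟨q, hq⟩ : ∃ q : Fin d, q ∉ ({y | Γ v y ∧ y ≠ v} : Finset V).image a := by
        by_contra! h
        have h1 : (univ : Finset (Fin d)) ⊆ ({y | Γ v y ∧ y ≠ v} : Finset V).image a :=
          fun q _ => h q
        have h2 := (card_le_card h1).trans card_image_le
        have h3 : ({y | Γ v y ∧ y ≠ v} : Finset V) ⊂ ({y | Γ v y} : Finset V) := by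
          refine (ssubset_iff_of_subset fun y => ?_).2 ⟨v, by simpa using hrefl v, by simp⟩
          simp +contextual
        have h4 := card_lt_card h3
        have h5 := hd v
        rw [card_univ, Fintype.card_fin] at h2
        omega
      have hq' : ∀ y, Γ v y → y ≠ v → a y ≠ q := fun y h1 h2 h3 =>
        hq (mem_image.2 ⟨y, by simp [h1, h2], h3⟩)
      refine ⟨Function.update a v q, fun x hx y hy hxy hΓ => ?_⟩
      rcases mem_insert.1 hx with rfl | hx <;> rcases mem_insert.1 hy with rfl | hy
      · exact absurd rfl hxy
      · rw [Function.update_self, Function.update_of_ne hxy.symm]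
        exact (hq' y hΓ hxy.symm).symm
      · rw [Function.update_self, Function.update_of_ne hxy]
        exact hq' x (hsymm _ _ hΓ) hxy
      · rw [Function.update_of_ne (ne_of_mem_of_not_mem hx hv),
          Function.update_of_ne (ne_of_mem_of_not_mem hy hv)]
        exact ha x hx y hy hxy hΓ
  obtain ⟨a, ha⟩ := key univ
  exact ⟨a, fun x y => ha x (mem_univ x) y (mem_univ y)⟩

/-! ### Transversals avoiding a relation without large complete bipartite graphs. -/

/-- If no `m` elements of `A` are joined completely to `m` elements of `D`, then fewer than `m`
elements of `A` have few non-neighbours in `D`. -/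
theorem card_few_nonneighbours_lt {α β : Type*} (B : α → β → Prop) (m : ℕ) (hm : 0 < m)
    (A : Finset α) (D : Finset β) (hD : 2 * m ≤ #D)
    (hfree : ¬ ∃ A' ⊆ A, ∃ D' ⊆ D, #A' = m ∧ #D' = m ∧ ∀ a ∈ A', ∀ b ∈ D', B a b) :
    #{a ∈ A | #{b ∈ D | ¬ B a b} * (2 * m) < #D} < m := by
  by_contra! h
  obtain ⟨A', hA', hcard⟩ := exists_subset_card_eq h
  -- Each of the `m` elements misses fewer than `#D / (2 * m)` of `D`, so together they miss at most
  -- half, and the remaining half has at least `m` elements.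
  have hcommon : m ≤ #{b ∈ D | ∀ a ∈ A', B a b} := by
    have h1 : D \ {b ∈ D | ∀ a ∈ A', B a b} ⊆ A'.biUnion fun a => {b ∈ D | ¬ B a b} := by
      intro b hb
      simp only [mem_sdiff, mem_filter, not_and, not_forall] at hb
      obtain ⟨a, ha, hab⟩ := hb.2 hb.1
      exact mem_biUnion.2 ⟨a, ha, by simp [hb.1, hab]⟩
    have h2 := (card_le_card h1).trans card_biUnion_le
    have h3 : (∑ a ∈ A', #{b ∈ D | ¬ B a b}) * (2 * m) ≤ m * #D := by
      rw [sum_mul]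
      calc _ ≤ #A' • #D := sum_le_card_nsmul _ _ _ fun a ha => (mem_filter.1 (hA' ha)).2.le
        _ = m * #D := by rw [hcard, smul_eq_mul]
    have h4 := card_sdiff_add_card_eq_card (filter_subset (fun b => ∀ a ∈ A', B a b) D)
    by_contra! h5
    have h6 : (∑ a ∈ A', #{b ∈ D | ¬ B a b}) * 2 ≤ #D := by
      refine Nat.le_of_mul_le_mul_left (c := m) ?_ hm
      linarith
    omega
  obtain ⟨D', hD', hDcard⟩ := exists_subset_card_eq hcommon
  exact hfree ⟨A', hA'.trans (filter_subset _ _), D', hD'.trans (filter_subset _ _), hcard, hDcard,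
    fun a ha b hb => (mem_filter.1 (hD' hb)).2 a ha⟩

/-- A transversal avoiding a bad relation which, between the candidate sets of any two adjacent
indices, contains no complete bipartite graph with parts of size `m`. -/
theorem exists_transversal {ι β : Type*} [Fintype ι] (E : ι → ι → Prop) (hE : ∀ i j, E i j → E j i)
    (Δ m : ℕ) (hm : 0 < m) (hΔ : ∀ i, #{j | E i j} ≤ Δ)
    (B : β → β → Prop) (hB : ∀ a b, B a b → B b a) (S : ι → Finset β)
    (hS : ∀ i, (2 * m + Δ * m + 1) * (2 * m) ^ Δ ≤ #(S i))
    (hfree : ∀ i j, i ≠ j → E i j →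
      ¬ ∃ A ⊆ S i, ∃ D ⊆ S j, #A = m ∧ #D = m ∧ ∀ a ∈ A, ∀ b ∈ D, B a b) :
    ∃ p : ι → β, (∀ i, p i ∈ S i) ∧ ∀ i j, i ≠ j → E i j → ¬ B (p i) (p j) := by
  -- `S' y` holds the candidates still compatible with the choices made on `J`. Each processed
  -- neighbour of `y` may cost a factor `2 * m`, and the exponent counts the neighbours still to
  -- come.
  have key : ∀ J : Finset ι, ∃ (p : ι → β) (S' : ι → Finset β),
      (∀ i ∈ J, p i ∈ S i) ∧ (∀ i ∈ J, ∀ j ∈ J, i ≠ j → E i j → ¬ B (p i) (p j)) ∧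
      (∀ y ∉ J, S' y ⊆ S y) ∧ (∀ y ∉ J, ∀ i ∈ J, E i y → ∀ b ∈ S' y, ¬ B (p i) b) ∧
      (∀ y ∉ J, (2 * m + Δ * m + 1) * (2 * m) ^ #{j | E y j ∧ j ∉ J} ≤ #(S' y)) := by
    intro J
    induction J using Finset.induction_on with
    | empty =>
      have hne : ∀ i, (S i).Nonempty := fun i => card_pos.1 ((by positivity : 0 < _).trans_le (hS i))
      refine ⟨fun i => (hne i).choose, S, by simp, by simp, by simp, by simp, fun y _ => ?_⟩
      refine le_trans ?_ (hS y)
      gcongr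
      · omega
      · simpa using hΔ y
    | insert x J hx ih =>
      obtain ⟨p, S', hp, hpJ, hS', hpS, hcard⟩ := ih
      have hbig : ∀ y ∉ J, 2 * m + Δ * m + 1 ≤ #(S' y) := fun y hy =>
        (Nat.le_mul_of_pos_right _ (by positivity)).trans (hcard y hy)
      -- Each of the at most `Δ` unprocessed neighbours spoils fewer than `m` candidates, and `S' x`
      -- has more than `Δ * m` of them.
      obtain ⟨b, hbS, hb⟩ : ∃ b ∈ S' x, ∀ y, E x y → y ∉ insert x J →
          #(S' y) ≤ #{b' ∈ S' y | ¬ B b b'} * (2 * m) := by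
        by_contra! h
        have h1 : S' x ⊆ ({y | E x y ∧ y ∉ insert x J} : Finset ι).biUnion fun y =>
            {b ∈ S' x | #{b' ∈ S' y | ¬ B b b'} * (2 * m) < #(S' y)} := by
          intro b hb
          obtain ⟨y, h1, h2, h3⟩ := h b hb
          exact mem_biUnion.2 ⟨y, by simpa [h1] using h2, mem_filter.2 ⟨hb, h3⟩⟩
        have h2 := (card_le_card h1).trans (card_biUnion_le_card_mul _ _ m fun y hy => ?_)
        · have h3 : #({y | E x y ∧ y ∉ insert x J} : Finset ι) ≤ Δ :=
            (card_le_card fun y => by simp +contextual).trans (hΔ x)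
          have h4 := hbig x hx
          have h5 := Nat.mul_le_mul_right m h3
          omega
        · simp only [mem_filter, mem_univ, true_and, mem_insert, not_or] at hy
          refine (card_few_nonneighbours_lt B m hm (S' x) (S' y) ?_ ?_).le
          · have := hbig y hy.2.2
            omega
          · rintro ⟨A, hA, D, hD, h⟩
            exact hfree x y (Ne.symm hy.2.1) hy.1 ⟨A, hA.trans (hS' x hx), D, hD.trans (hS' y hy.2.2), h⟩
      refine ⟨Function.update p x b,
        fun y => if E x y then {b' ∈ S' y | ¬ B b b'} else S' y, ?_, ?_, ?_, ?_, ?_⟩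
      · intro i hi
        rcases mem_insert.1 hi with rfl | hi
        · rw [Function.update_self]; exact hS' _ hx hbS
        · rw [Function.update_of_ne (ne_of_mem_of_not_mem hi hx)]; exact hp i hi
      · intro i hi j hj hij hEij
        rcases mem_insert.1 hi with rfl | hi' <;> rcases mem_insert.1 hj with rfl | hj'
        · exact absurd rfl hij
        · rw [Function.update_self, Function.update_of_ne hij.symm]
          exact fun h => hpS _ hx j hj' (hE _ _ hEij) b hbS (hB _ _ h)
        · rw [Function.update_self, Function.update_of_ne hij]
          exact hpS _ hx i hi' hEij b hbS
        · rw [Function.update_of_ne (ne_of_mem_of_not_mem hi' hx),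
            Function.update_of_ne (ne_of_mem_of_not_mem hj' hx)]
          exact hpJ i hi' j hj' hij hEij
      · intro y hy
        have hyJ : y ∉ J := fun h => hy (mem_insert_of_mem h)
        dsimp only
        split_ifs
        · exact (filter_subset _ _).trans (hS' y hyJ)
        · exact hS' y hyJ
      · intro y hy i hi hEiy b' hb'
        have hyJ : y ∉ J := fun h => hy (mem_insert_of_mem h)
        dsimp only at hb'
        rcases mem_insert.1 hi with rfl | hi
        · rw [Function.update_self]
          rw [if_pos hEiy] at hb'
          exact (mem_filter.1 hb').2
        · rw [Function.update_of_ne (ne_of_mem_of_not_mem hi hx)]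
          refine hpS y hyJ i hi hEiy b' ?_
          split_ifs at hb'
          · exact (mem_filter.1 hb').1
          · exact hb'
      · intro y hy
        have hyJ : y ∉ J := fun h => hy (mem_insert_of_mem h)
        have hle := hcard y hyJ
        dsimp only
        split_ifs with hExy
        · have hcount : #{j | E y j ∧ j ∉ J} = #{j | E y j ∧ j ∉ insert x J} + 1 := by
            rw [← card_insert_of_notMem (a := x) (by simp)]
            congr 1
            ext j
            simp only [mem_filter, mem_univ, true_and, mem_insert, not_or]
            constructor
            · rintro ⟨h1, h2⟩
              by_cases h : j = x
              · exact Or.inl h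
              · exact Or.inr ⟨h1, h, h2⟩
            · rintro (rfl | ⟨h1, -, h2⟩)
              · exact ⟨hE _ _ hExy, hx⟩
              · exact ⟨h1, h2⟩
          rw [hcount, pow_succ, ← mul_assoc] at hle
          exact Nat.le_of_mul_le_mul_right (hle.trans (hb y hExy hy)) (by omega)
        · refine le_trans ?_ hle
          gcongr
          · omega
          · simp
  obtain ⟨p, -, hp, hpE, -⟩ := key univ
  exact ⟨p, fun i => hp i (mem_univ i), fun i j => hpE i (mem_univ i) j (mem_univ j)⟩

/-! ### Depth-first search and separated families. -/

/-- Depth-first search: if all paths of `R` inside `U` are short, then `U` splits, up to a short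
path, into two sets without relations from the first to the second. -/
theorem exists_separated_pair {V : Type*} (R : V → V → Prop) (n : ℕ) (U : Finset V)
    (hpath : ∀ P : List V, P.Nodup → P.IsChain R → (∀ x ∈ P, x ∈ U) → P.length < n)
    (t : ℕ) (ht : t ≤ #U) :
    ∃ A ⊆ U, ∃ D ⊆ U, Disjoint A D ∧ #A = t ∧ #U ≤ #A + #D + n ∧ ∀ a ∈ A, ∀ b ∈ D, ¬ R a b := by
  -- `A` is the set of finished vertices, `D` the unvisited ones, and `P` the stack with its top at
  -- the head, hence the reversed relation.
  let State (A D : Finset V) (P : List V) : Prop :=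
    A ⊆ U ∧ D ⊆ U ∧ Disjoint A D ∧ (∀ a ∈ A, ∀ b ∈ D, ¬ R a b) ∧ P.Nodup ∧
      P.IsChain (fun x y => R y x) ∧ (∀ x ∈ P, x ∈ U ∧ x ∉ A ∧ x ∉ D) ∧
      #A + #D + P.length = #U
  have key : ∀ t ≤ #U, ∃ A D P, State A D P ∧ #A = t := by
    intro t
    induction t with
    | zero => exact fun _ => ⟨∅, U, [], by simp [State], by simp⟩
    | succ t ih =>
      intro ht
      obtain ⟨A₀, D₀, P₀, h₀, hA₀⟩ := ih (by omega)
      -- With `#A = t` fixed, minimise `#D`: no further push is possible, so the top of the stack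
      -- has no neighbour in `D` and can be moved to `A`.
      have hex : ∃ l A D P, State A D P ∧ #A = t ∧ #D = l := ⟨_, _, _, _, h₀, hA₀, rfl⟩
      obtain ⟨A, D, P, ⟨hAU, hDU, hAD, hR, hnd, hch, hP, hsum⟩, hA, hD⟩ := Nat.find_spec hex
      have hmin : ∀ A' D' P', State A' D' P' → #A' = t → #D ≤ #D' := fun A' D' P' h1 h2 =>
        hD ▸ Nat.find_min' hex ⟨A', D', P', h1, h2, rfl⟩
      have push : ∀ v ∈ D, (v :: P).IsChain (fun x y => R y x) → False := by
        intro v hv hchain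
        have hvA : v ∉ A := fun h => disjoint_left.1 hAD h hv
        have hcard := card_erase_of_mem hv
        have hpos : 0 < #D := card_pos.2 ⟨v, hv⟩
        have := hmin A (D.erase v) (v :: P)
          ⟨hAU, (erase_subset _ _).trans hDU, hAD.mono_right (erase_subset _ _),
            fun a ha b hb => hR a ha b (mem_of_mem_erase hb),
            List.nodup_cons.2 ⟨fun h => (hP v h).2.2 hv, hnd⟩, hchain, by
              intro x hx
              rcases List.mem_cons.1 hx with rfl | hx
              · exact ⟨hDU hv, hvA, by simp⟩
              · exact ⟨(hP x hx).1, (hP x hx).2.1, fun h => (hP x hx).2.2 (mem_of_mem_erase h)⟩,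
            by simp only [List.length_cons]; omega⟩ hA
        omega
      match P, hnd, hch, hP, hsum, push with
      | [], _, _, _, hsum, push =>
        obtain ⟨v, hv⟩ : D.Nonempty := card_pos.1 (by simp at hsum; omega)
        exact (push v hv (by simp)).elim
      | v :: P, hnd, hch, hP, hsum, push =>
        have hv := hP v (by simp)
        refine ⟨insert v A, D, P, ⟨insert_subset hv.1 hAU, hDU,
          disjoint_insert_left.2 ⟨hv.2.2, hAD⟩, ?_, (List.nodup_cons.1 hnd).2, hch.tail, ?_, ?_⟩, ?_⟩
        · intro a ha b hb hab
          rcases mem_insert.1 ha with rfl | ha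
          · exact push b hb (List.isChain_cons_cons.2 ⟨hab, hch⟩)
          · exact hR a ha b hb hab
        · intro x hx
          have hx' := hP x (by simp [hx])
          refine ⟨hx'.1, ?_, hx'.2.2⟩
          rw [mem_insert, not_or]
          refine ⟨?_, hx'.2.1⟩
          rintro rfl
          exact (List.nodup_cons.1 hnd).1 hx
        · rw [card_insert_of_notMem hv.2.1]
          simp only [List.length_cons] at hsum
          omega
        · rw [card_insert_of_notMem hv.2.1, hA]
  obtain ⟨A, D, P, ⟨hAU, hDU, hAD, hR, hnd, hch, hP, hsum⟩, hA⟩ := key t ht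
  refine ⟨A, hAU, D, hDU, hAD, hA, ?_, hR⟩
  have := hpath P.reverse (List.nodup_reverse.2 hnd) (List.isChain_reverse.2 hch)
    (fun x hx => (hP x (List.mem_reverse.1 hx)).1)
  rw [List.length_reverse] at this
  omega

/-- Peel off one set of size `t` and continue inside the other side `D` of the separated pair; each
round costs at most `t + n` elements, and all later sets lie in `D`. -/
theorem exists_separated_sequence {V : Type*} (R : V → V → Prop) (n t l : ℕ) (U : Finset V)
    (hpath : ∀ P : List V, P.Nodup → P.IsChain R → (∀ x ∈ P, x ∈ U) → P.length < n)
    (hU : l * (t + n) ≤ #U) :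
    ∃ X : ℕ → Finset V, ∀ i < l, X i ⊆ U ∧ #(X i) = t ∧
      ∀ j < l, i < j → Disjoint (X i) (X j) ∧ ∀ a ∈ X i, ∀ b ∈ X j, ¬ R a b := by
  induction l generalizing U with
  | zero => exact ⟨fun _ => ∅, by simp⟩
  | succ l ih =>
    rw [add_mul, one_mul] at hU
    obtain ⟨A, hA, D, hD, hAD, hAt, hUle, hR⟩ :=
      exists_separated_pair R n U hpath t (by omega)
    obtain ⟨X, hX⟩ := ih D (fun P h1 h2 h3 => hpath P h1 h2 fun x hx => hD (h3 x hx)) (by omega)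
    refine ⟨fun i => i.casesOn A X, fun i hi => ?_⟩
    cases i with
    | zero =>
      refine ⟨hA, hAt, fun j hj hij => ?_⟩
      obtain ⟨j, rfl⟩ := Nat.exists_eq_add_of_lt hij
      have hXj := (hX (0 + j) (by omega)).1
      exact ⟨hAD.mono_right hXj, fun a ha b hb => hR a ha b (hXj hb)⟩
    | succ i =>
      obtain ⟨h1, h2, h3⟩ := hX i (by omega)
      refine ⟨h1.trans hD, h2, fun j hj hij => ?_⟩
      cases j with
      | zero => omega
      | succ j => exact h3 j (by omega) (by omega)

/-- If all paths of a symmetric relation `R` inside a large set `U` are short, then `U` contains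
many large sets with no relations between them. -/
theorem exists_separated_family {V ι : Type*} [Fintype ι] (R : V → V → Prop)
    (hsymm : ∀ x y, R x y → R y x) (n t : ℕ) (U : Finset V)
    (hpath : ∀ P : List V, P.Nodup → P.IsChain R → (∀ x ∈ P, x ∈ U) → P.length < n)
    (hU : Fintype.card ι * (t + n) ≤ #U) :
    ∃ X : ι → Finset V, (∀ i, X i ⊆ U ∧ #(X i) = t) ∧
      ∀ i j, i ≠ j → Disjoint (X i) (X j) ∧ ∀ a ∈ X i, ∀ b ∈ X j, ¬ R a b := by
  obtain ⟨X, hX⟩ := exists_separated_sequence R n t _ U hpath hU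
  let e := Fintype.equivFin ι
  refine ⟨fun i => X (e i), fun i => ⟨(hX _ (e i).2).1, (hX _ (e i).2).2.1⟩, fun i j hij => ?_⟩
  have hne : (e i : ℕ) ≠ e j := fun h => hij (e.injective (Fin.ext h))
  rcases lt_or_gt_of_ne hne with h | h
  · exact (hX _ (e i).2).2.2 _ (e j).2 h
  · obtain ⟨h1, h2⟩ := (hX _ (e j).2).2.2 _ (e i).2 h
    exact ⟨h1.symm, fun a ha b hb hab => h2 b hb a ha (hsymm _ _ hab)⟩

/-! ### Path powers from chains of cliques. -/

/-- `R` contains the `k`-th power of a path on `n` vertices. -/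
def ContainsPathPower {β : Type*} (n k : ℕ) (R : β → β → Prop) : Prop :=
  ∃ f : ℕ → β, (∀ i < n, ∀ j < n, f i = f j → i = j) ∧
    ∀ i j, i < j → j < n → j ≤ i + k → R (f i) (f j)

theorem exists_enumeration {β : Type*} (k : ℕ) (hk : 0 < k) (Q : Finset β) (hQ : #Q = k) :
    ∃ e : ℕ → β, (∀ i < k, e i ∈ Q) ∧ ∀ i < k, ∀ j < k, e i = e j → i = j := by
  have e := Q.equivFinOfCardEq hQ
  refine ⟨fun i => e.symm ⟨i % k, Nat.mod_lt _ hk⟩, fun i _ => (e.symm _).2, fun i hi j hj h => ?_⟩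
  have := congrArg Fin.val (e.symm.injective (Subtype.ext h))
  simpa [Nat.mod_eq_of_lt hi, Nat.mod_eq_of_lt hj] using this

/-- A long path of disjoint cliques, consecutive ones being joined by large complete bipartite
graphs, contains a path power. -/
theorem containsPathPower_of_chain {V β : Type*} (n k : ℕ) (hk : 0 < k) (red : β → β → Prop)
    (S : V → Finset β) (hdisj : ∀ u v, u ≠ v → Disjoint (S u) (S v))
    (hclique : ∀ v, ∀ x ∈ S v, ∀ y ∈ S v, x ≠ y → red x y) (P : List V) (hnd : P.Nodup)
    (hchain : P.IsChain fun u v => ∃ A ⊆ S u, ∃ D ⊆ S v, #A = 2 * k ∧ #D = 2 * k ∧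
      ∀ a ∈ A, ∀ b ∈ D, red a b)
    (hlen : n + 2 ≤ P.length) : ContainsPathPower n k red := by
  have hstep : ∀ i, ∃ A D : Finset β, ∀ h : i < n + 1, A ⊆ S (P[i]) ∧
      D ⊆ S (P[i + 1]) ∧ #A = 2 * k ∧ #D = 2 * k ∧ ∀ a ∈ A, ∀ b ∈ D, red a b := by
    intro i
    by_cases h : i < n + 1
    · obtain ⟨A, hA, D, hD, h1⟩ := List.isChain_iff_getElem.1 hchain i (by omega)
      exact ⟨A, D, fun _ => ⟨hA, hD, h1⟩⟩
    · exact ⟨∅, ∅, fun h' => absurd h' h⟩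
  choose A D hAD using hstep
  -- Block `i` lies in the clique at `P[i + 1]`: its first `k` vertices face the previous clique and
  -- its last `k` face the next. The sides have size `2 * k` so that the second half can avoid the
  -- first. Block `n - 1` needs the link from `P[n]` to `P[n + 1]`, whence length `n + 2`.
  have hblock : ∀ i, ∃ e : ℕ → β, i < n →
      (∀ j < k, e j ∈ D i) ∧ (∀ j, k ≤ j → j < 2 * k → e j ∈ A (i + 1)) ∧
      ∀ j < 2 * k, ∀ j' < 2 * k, e j = e j' → j = j' := by
    intro i
    by_cases hi : i < n
    · obtain ⟨-, -, -, hDcard, -⟩ := hAD i (by omega)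
      obtain ⟨-, -, hAcard, -, -⟩ := hAD (i + 1) (by omega)
      obtain ⟨I, hI, hIcard⟩ := exists_subset_card_eq (by omega : k ≤ #(D i))
      obtain ⟨O, hO, hOcard⟩ := exists_subset_card_eq
        (show k ≤ #(A (i + 1) \ I) from le_trans (by omega) (le_card_sdiff I (A (i + 1))))
      obtain ⟨e₁, he₁, hinj₁⟩ := exists_enumeration k hk I hIcard
      obtain ⟨e₂, he₂, hinj₂⟩ := exists_enumeration k hk O hOcard
      have hne : ∀ j < k, ∀ j' < k, e₁ j ≠ e₂ j' := fun j hj j' hj' h =>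
        (mem_sdiff.1 (hO (he₂ j' hj'))).2 (h ▸ he₁ j hj)
      refine ⟨fun j => if j < k then e₁ j else e₂ (j - k), fun _ => ⟨?_, ?_, ?_⟩⟩
      · intro j hj
        simpa [hj] using hI (he₁ j hj)
      · intro j hj hj'
        simpa [not_lt.2 hj] using (mem_sdiff.1 (hO (he₂ (j - k) (by omega)))).1
      · intro j hj j' hj' h
        dsimp only at h
        split_ifs at h with h1 h2 h2
        · exact hinj₁ j h1 j' h2 h
        · exact absurd h (hne _ h1 _ (by omega))
        · exact absurd h.symm (hne _ h2 _ (by omega))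
        · have := hinj₂ _ (by omega) _ (by omega) h
          omega
    · have hpos : 0 < #(A 0) := by
        rw [(hAD 0 (by omega)).2.2.1]
        omega
      exact ⟨fun _ => (card_pos.1 hpos).choose, fun h => absurd h hi⟩
  choose e he using hblock
  have hmem : ∀ i, ∀ h : i < n, ∀ j < 2 * k, e i j ∈ S (P[i + 1]) := by
    intro i hi j hj
    by_cases hjk : j < k
    · exact (hAD i (by omega)).2.1 ((he i hi).1 j hjk)
    · exact (hAD (i + 1) (by omega)).1 ((he i hi).2.1 j (by omega) hj)
  have hlt : ∀ t < n, t / (2 * k) < n := fun t ht => (Nat.div_le_self _ _).trans_lt ht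
  have hmod : ∀ t, t % (2 * k) < 2 * k := fun t => Nat.mod_lt _ (by omega)
  have hinj : ∀ t < n, ∀ t' < n, e (t / (2 * k)) (t % (2 * k)) = e (t' / (2 * k)) (t' % (2 * k)) →
      t = t' := by
    intro t ht t' ht' h
    have hq : t / (2 * k) = t' / (2 * k) := by
      by_contra hq
      refine disjoint_left.1 (hdisj _ _ fun hP => hq ?_) (hmem _ (hlt t ht) _ (hmod t))
        (h ▸ hmem _ (hlt t' ht') _ (hmod t'))
      have := (List.Nodup.getElem_inj_iff hnd).1 hP
      omega
    rw [hq] at h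
    have hr := (he _ (hlt t' ht')).2.2 _ (hmod t) _ (hmod t') h
    rw [← Nat.div_add_mod t (2 * k), ← Nat.div_add_mod t' (2 * k), hq, hr]
  refine ⟨fun t => e (t / (2 * k)) (t % (2 * k)), hinj, fun t t' htt' ht' hle => ?_⟩
  have ht : t < n := by omega
  have hd := Nat.div_add_mod t (2 * k)
  have hd' := Nat.div_add_mod t' (2 * k)
  have hqle : t / (2 * k) ≤ t' / (2 * k) := Nat.div_le_div_right htt'.le
  have hqle' : t' / (2 * k) ≤ t / (2 * k) + 1 := by
    rw [← Nat.add_div_right _ (by omega : 0 < 2 * k)]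
    exact Nat.div_le_div_right (by omega)
  have hm := hmod t
  have hm' := hmod t'
  rcases eq_or_lt_of_le hqle with hq | hq
  · refine hclique _ _ (hmem _ (hlt t ht) _ (hmod t)) _ (by
      simp only [hq]; exact hmem _ (hlt t' ht') _ (hmod t')) fun h => ?_
    have := hinj t ht t' ht' h
    omega
  -- Indices in consecutive blocks at distance at most `k` lie in the second half of one block and
  -- the first half of the next, which are completely joined.
  · have hq' : t' / (2 * k) = t / (2 * k) + 1 := by omega
    have hlt' := hlt t' ht'
    dsimp only
    rw [hq'] at hd' hlt' ⊢
    rw [mul_add] at hd'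
    exact (hAD (t / (2 * k) + 1) (by omega)).2.2.2.2 _ ((he _ (hlt t ht)).2.1 _ (by omega) hm) _
      ((he _ hlt').1 _ (by omega))

/-! ### Bounded-degree expanders by random choice. -/

/-- The values `F w i` are constrained independently, so the count is a product. Divided by the
number of all `F`, it is the failure probability in the union bound below. -/
theorem card_functions_avoiding {N d : ℕ} (A Y : Finset (Fin N)) :
    #{F : Fin N → Fin d → Fin N | ∀ w ∈ A, ∀ i, F w i ∉ Y} =
      ((N - #Y) ^ d) ^ #A * (N ^ d) ^ (N - #A) := by
  have h1 : ({F : Fin N → Fin d → Fin N | ∀ w ∈ A, ∀ i, F w i ∉ Y} : Finset _) =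
      Fintype.piFinset fun w => Fintype.piFinset fun _ => if w ∈ A then Yᶜ else univ := by
    ext F
    simp only [mem_filter, mem_univ, true_and, Fintype.mem_piFinset]
    refine forall_congr' fun w => ?_
    by_cases hw : w ∈ A <;> simp [hw]
  rw [h1, Fintype.card_piFinset]
  simp only [Fintype.card_piFinset, prod_const, card_univ, Fintype.card_fin]
  have h2 : ∀ w : Fin N, #(if w ∈ A then Yᶜ else univ) ^ d =
      if w ∈ A then (N - #Y) ^ d else N ^ d := by
    intro w
    split_ifs <;> simp [card_compl]
  simp only [h2]
  rw [prod_ite, prod_const, prod_const]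
  congr 2
  · simp
  · rw [filter_not, card_sdiff_of_subset (filter_subset _ _)]
    simp

/-- A random `d`-tuple of functions joins any two sets of linear size. -/
theorem exists_functions_hitting (K : ℕ) (hK : 0 < K) :
    ∃ d, 0 < d ∧ ∀ N, 0 < N → ∃ F : Fin N → Fin d → Fin N, ∀ A Y : Finset (Fin N),
      N ≤ K * #A → N ≤ K * #Y → ∃ w ∈ A, ∃ i, F w i ∈ Y := by
  -- A fixed pair `A`, `Y` fails with probability at most `(1 - 1 / K) ^ (d * #A)`, hence at most
  -- `(1 - 1 / K) ^ (d₁ * N)`. The threshold `1 / 4` beats the at most `4 ^ N` pairs.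
  obtain ⟨d₁, hd₁⟩ : ∃ d₁ : ℕ, (1 - 1 / (K : ℝ)) ^ d₁ < 1 / 4 :=
    exists_pow_lt_of_lt_one (by norm_num) (by
      have : (0 : ℝ) < 1 / K := by positivity
      linarith)
  have hK1 : (0 : ℝ) ≤ 1 - 1 / (K : ℝ) := by
    rw [sub_nonneg, div_le_one (by positivity)]
    exact_mod_cast hK
  refine ⟨K * d₁ + 1, by omega, fun N hN => ?_⟩
  set d := K * d₁ + 1
  by_contra! h
  have hcover : (univ : Finset (Fin N → Fin d → Fin N)) ⊆
      ({p : Finset (Fin N) × Finset (Fin N) | N ≤ K * #p.1 ∧ N ≤ K * #p.2} : Finset _).biUnion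
        fun p => {F | ∀ w ∈ p.1, ∀ i, F w i ∉ p.2} := by
    intro F _
    obtain ⟨A, Y, hA, hY, hF⟩ := h F
    exact mem_biUnion.2 ⟨(A, Y), by simp [hA, hY], by simpa using hF⟩
  have hN' : (0 : ℝ) < N := by exact_mod_cast hN
  have hbound : ∀ p ∈ ({p : Finset (Fin N) × Finset (Fin N) | N ≤ K * #p.1 ∧ N ≤ K * #p.2} :
      Finset _), (#{F : Fin N → Fin d → Fin N | ∀ w ∈ p.1, ∀ i, F w i ∉ p.2} : ℝ) ≤
        ((1 - 1 / (K : ℝ)) ^ d₁) ^ N * ((N : ℝ) ^ d) ^ N := by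
    rintro ⟨A, Y⟩ hp
    obtain ⟨hA, hY⟩ := (mem_filter.1 hp).2
    dsimp only at hA hY ⊢
    have hAN : #A ≤ N := by simpa using card_le_univ A
    have hYN : #Y ≤ N := by simpa using card_le_univ Y
    have hfrac : ((N - #Y : ℕ) : ℝ) ≤ (1 - 1 / K) * N := by
      rw [Nat.cast_sub hYN]
      have : (N : ℝ) / K ≤ #Y := by
        rw [div_le_iff₀ (by positivity)]
        calc (N : ℝ) ≤ (K * #Y : ℕ) := by exact_mod_cast hY
          _ = #Y * K := by push_cast; ring
      calc (N : ℝ) - #Y ≤ N - N / K := by linarith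
        _ = _ := by ring
    rw [card_functions_avoiding]
    push_cast
    calc (((N - #Y : ℕ) : ℝ) ^ d) ^ #A * ((N : ℝ) ^ d) ^ (N - #A)
        ≤ (((1 - 1 / K) * N) ^ d) ^ #A * ((N : ℝ) ^ d) ^ (N - #A) := by gcongr
      _ = (1 - 1 / (K : ℝ)) ^ (d * #A) * ((N : ℝ) ^ d) ^ N := by
        rw [mul_pow, mul_pow, mul_assoc, ← pow_add, Nat.add_sub_cancel' hAN, ← pow_mul]
      _ ≤ (1 - 1 / (K : ℝ)) ^ (d₁ * N) * ((N : ℝ) ^ d) ^ N := by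
        refine mul_le_mul_of_nonneg_right (pow_le_pow_of_le_one hK1 ?_ ?_) (by positivity)
        · have : (0 : ℝ) ≤ 1 / K := by positivity
          linarith
        · calc d₁ * N ≤ d₁ * (K * #A) := Nat.mul_le_mul_left _ hA
            _ = K * d₁ * #A := by ring
            _ ≤ d * #A := Nat.mul_le_mul_right _ (by omega)
      _ = _ := by rw [pow_mul]
  have hcount : (((N : ℝ) ^ d) ^ N) ≤ 4 ^ N * (((1 - 1 / (K : ℝ)) ^ d₁) ^ N * ((N : ℝ) ^ d) ^ N) := by
    have h1 := (card_le_card hcover).trans card_biUnion_le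
    have h2 : ((#(univ : Finset (Fin N → Fin d → Fin N)) : ℕ) : ℝ) = ((N : ℝ) ^ d) ^ N := by
      simp
    refine h2.symm.le.trans ((Nat.cast_le.2 h1).trans ?_)
    rw [Nat.cast_sum]
    refine (sum_le_card_nsmul _ _ _ hbound).trans ?_
    rw [nsmul_eq_mul]
    refine mul_le_mul_of_nonneg_right ?_
      (mul_nonneg (pow_nonneg (pow_nonneg hK1 _) _) (pow_nonneg (pow_nonneg hN'.le _) _))
    have h3 : #({p : Finset (Fin N) × Finset (Fin N) | N ≤ K * #p.1 ∧ N ≤ K * #p.2} : Finset _)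
        ≤ 4 ^ N := by
      refine (card_le_univ _).trans_eq ?_
      simp only [Fintype.card_prod, Fintype.card_finset, Fintype.card_fin]
      rw [← mul_pow]; norm_num
    exact_mod_cast h3
  have hlt : (4 : ℝ) ^ N * ((1 - 1 / (K : ℝ)) ^ d₁) ^ N < 1 := by
    rw [← mul_pow]
    refine pow_lt_one₀ (mul_nonneg (by norm_num) (pow_nonneg hK1 _)) ?_ hN.ne'
    linarith
  have hpos : (0 : ℝ) < ((N : ℝ) ^ d) ^ N := by positivity
  nlinarith

/-- Relations of bounded degree in which the out-neighbourhoods of all but few vertices meet a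
given set of linear size. -/
theorem exists_bounded_degree_expander (K : ℕ) (hK : 0 < K) :
    ∃ d, ∀ N, 0 < N → ∃ G : Fin N → Fin N → Prop, (∀ x, G x x) ∧ (∀ x, #{y | G x y} ≤ d) ∧
      (∀ y, #{x | G x y} ≤ d) ∧
      ∀ X : Finset (Fin N), N ≤ K * #X → K * #{w | ∀ x ∈ X, ¬ G w x} < N := by
  -- The factor `2` pays for `High`, the points of too large in-degree: they number at most `N / (2
  -- * K)`, and all arcs into them except loops are dropped.
  obtain ⟨d, hd, hF⟩ := exists_functions_hitting (2 * K) (by omega)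
  refine ⟨2 * K * d + 1, fun N hN => ?_⟩
  obtain ⟨F, hF⟩ := hF N hN
  let inset : Fin N → Finset (Fin N × Fin d) := fun y => {q | F q.1 q.2 = y}
  let High : Finset (Fin N) := {y | 2 * K * d < #(inset y)}
  have hHigh : 2 * K * #High ≤ N := by
    have h1 : ∑ y ∈ High, #(inset y) ≤ N * d := by
      calc ∑ y ∈ High, #(inset y) ≤ ∑ y, #(inset y) :=
            sum_le_sum_of_subset (subset_univ _)
        _ = #(univ : Finset (Fin N × Fin d)) :=
            (card_eq_sum_card_fiberwise fun _ _ => mem_univ _).symm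
        _ = N * d := by simp
    have h2 : #High • (2 * K * d) ≤ ∑ y ∈ High, #(inset y) :=
      card_nsmul_le_sum _ _ _ fun y hy => (mem_filter.1 hy).2.le
    rw [smul_eq_mul] at h2
    refine Nat.le_of_mul_le_mul_right (c := d) ?_ hd
    calc 2 * K * #High * d = #High * (2 * K * d) := by ring
      _ ≤ N * d := h2.trans h1
  obtain ⟨G, hG⟩ : ∃ G : Fin N → Fin N → Prop,
      ∀ w x, G w x ↔ w = x ∨ (∃ i, F w i = x) ∧ x ∉ High := ⟨_, fun _ _ => Iff.rfl⟩
  refine ⟨G, fun x => (hG x x).2 (Or.inl rfl), ?_, ?_, ?_⟩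
  · intro w
    have h1 : ({x | G w x} : Finset (Fin N)) ⊆
        insert w (univ.image (F w)) := by
      intro x hx
      rcases (hG _ _).1 (mem_filter.1 hx).2 with rfl | ⟨⟨i, rfl⟩, -⟩ <;> simp
    have h2 : #(univ.image (F w)) ≤ d := card_image_le.trans (by simp)
    have h3 := (card_le_card h1).trans (card_insert_le _ _)
    have h4 : d ≤ 2 * K * d := Nat.le_mul_of_pos_left _ (by omega)
    omega
  · intro x
    by_cases hx : x ∈ High
    · have h1 : ({w | G w x} : Finset (Fin N)) ⊆ {x} := by
        intro w hw
        simpa [hx, hG] using hw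
      have := card_le_card h1
      rw [card_singleton] at this
      omega
    · have h1 : ({w | G w x} : Finset (Fin N)) ⊆
          insert x ((inset x).image Prod.fst) := by
        intro w hw
        rcases (hG _ _).1 (mem_filter.1 hw).2 with rfl | ⟨⟨i, hi⟩, -⟩
        · simp
        · exact mem_insert_of_mem (mem_image.2 ⟨(w, i), by simp [inset, hi], rfl⟩)
      have h2 : #(inset x) ≤ 2 * K * d := by simpa [High] using hx
      have h3 := (card_le_card h1).trans (card_insert_le _ _)
      have h4 : #((inset x).image Prod.fst) ≤ _ := card_image_le
      omega
  · intro X hX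
    by_contra h
    rw [not_lt] at h
    have hY : N ≤ 2 * K * #(X \ High) := by
      have h1 : #X - #High ≤ #(X \ High) := le_card_sdiff High X
      have h2 : 2 * K * #X ≤ 2 * K * (#(X \ High) + #High) := Nat.mul_le_mul_left _ (by omega)
      rw [mul_add] at h2
      have h3 : 2 * K * #X = 2 * (K * #X) := by ring
      omega
    obtain ⟨w, hw, i, hi⟩ := hF _ _ (h.trans (Nat.mul_le_mul_right _ (by omega))) hY
    obtain ⟨h1, h2⟩ := mem_sdiff.1 hi
    exact (mem_filter.1 hw).2 _ h1 ((hG _ _).2 (Or.inr ⟨⟨i, rfl⟩, h2⟩))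

/-! ### Several representatives in each clique. -/

theorem exists_disjoint_parts {β : Type*} (d t : ℕ) (S : Finset β) (hS : #S = d * t) :
    ∃ Q : Fin d → Finset β, (∀ h, Q h ⊆ S ∧ #(Q h) = t) ∧ ∀ h h', h ≠ h' → Disjoint (Q h) (Q h') := by
  let e := (finProdFinEquiv (m := d) (n := t)).trans (S.equivFinOfCardEq hS).symm
  have he : Function.Injective fun q => (e q : β) := Subtype.val_injective.comp e.injective
  refine ⟨fun h => univ.image fun q => (e (h, q) : β), fun h => ⟨?_, ?_⟩, fun h h' hne => ?_⟩
  · intro x hx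
    obtain ⟨q, -, rfl⟩ := mem_image.1 hx
    exact (e (h, q)).2
  · rw [card_image_of_injective _ fun q q' hq => (Prod.mk.inj (he hq)).2]
    simp
  · rw [disjoint_left]
    intro x hx hx'
    obtain ⟨q, -, rfl⟩ := mem_image.1 hx
    obtain ⟨q', -, hq⟩ := mem_image.1 hx'
    exact hne (Prod.mk.inj (he hq)).1.symm

theorem exists_injOn_fin {α : Type*} (d : ℕ) (hd : 0 < d) (S : Finset α) (hS : #S ≤ d) :
    ∃ f : α → Fin d, ∀ x ∈ S, ∀ y ∈ S, f x = f y → x = y := by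
  refine ⟨fun x => if h : x ∈ S then Fin.castLE hS (S.equivFin ⟨x, h⟩) else ⟨0, hd⟩,
    fun x hx y hy h => ?_⟩
  simpa [hx, hy] using h

/-- A system of `d` distinct representatives in each set `S x`, no two of which, for adjacent
indices, are related by `red`. -/
theorem exists_transversal_slots {V β : Type*} [Fintype V] [Nonempty β] (E : V → V → Prop)
    (hE : ∀ x y, E x y → E y x) (D d m : ℕ) (hm : 0 < m) (hD : ∀ x, #{y | E x y} ≤ D)
    (red : β → β → Prop) (hred : ∀ a b, red a b → red b a) (W : Finset V) (S : V → Finset β)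
    (hS : ∀ x ∈ W, #(S x) = d * ((2 * m + D * d * m + 1) * (2 * m) ^ (D * d)))
    (hfree : ∀ x ∈ W, ∀ y ∈ W, x ≠ y → E x y →
      ¬ ∃ A ⊆ S x, ∃ A' ⊆ S y, #A = m ∧ #A' = m ∧ ∀ a ∈ A, ∀ b ∈ A', red a b) :
    ∃ p : V → Fin d → β, (∀ x ∈ W, ∀ h, p x h ∈ S x) ∧
      (∀ x ∈ W, Function.Injective (p x)) ∧
      ∀ x ∈ W, ∀ y ∈ W, x ≠ y → E x y → ∀ h h', ¬ red (p x h) (p y h') := by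
  have hparts := fun x : W => exists_disjoint_parts d _ (S x) (hS x x.2)
  choose Q hQ hQdisj using hparts
  -- Each `S x` is split into `d` pieces, one per slot. Pieces of the same `x` are left unrelated,
  -- since nothing is demanded between them.
  obtain ⟨p, hp, hpE⟩ := exists_transversal (ι := W × Fin d)
    (fun i j => i.1 ≠ j.1 ∧ E i.1 j.1) (fun i j h => ⟨h.1.symm, hE _ _ h.2⟩) (D * d) m hm
    (by
      rintro ⟨x, h⟩
      refine (card_le_card_of_injOn (t := ({y | E x y} : Finset V) ×ˢ (univ : Finset (Fin d)))
        (fun j => ((j.1 : V), j.2)) ?_ ?_).trans ?_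
      · intro j hj
        simp only [coe_filter, mem_univ, true_and] at hj
        simpa using hj.2
      · rintro ⟨⟨y, hy⟩, h⟩ - ⟨⟨y', hy'⟩, h'⟩ - heq
        simpa using heq
      · rw [card_product, card_univ, Fintype.card_fin]
        exact Nat.mul_le_mul_right _ (hD x))
    red hred (fun i => Q i.1 i.2) (fun i => (hQ i.1 i.2).2.ge)
    (by
      rintro ⟨x, h⟩ ⟨y, h'⟩ - ⟨hxy, hExy⟩ ⟨A, hA, A', hA', hrest⟩
      exact hfree x x.2 y y.2 (fun h => hxy (Subtype.ext h)) hExy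
        ⟨A, hA.trans (hQ x h).1, A', hA'.trans (hQ y h').1, hrest⟩)
  refine ⟨fun x h => if hx : x ∈ W then p (⟨x, hx⟩, h) else Classical.arbitrary β, ?_, ?_, ?_⟩
  · intro x hx h
    simpa [hx] using (hQ ⟨x, hx⟩ h).1 (hp (⟨x, hx⟩, h))
  · intro x hx h h' heq
    simp only [hx, dite_true] at heq
    by_contra hne
    exact disjoint_left.1 (hQdisj ⟨x, hx⟩ h h' hne) (hp (⟨x, hx⟩, h)) (heq ▸ hp (⟨x, hx⟩, h'))
  · intro x hx y hy hxy hExy h h'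
    simp only [hx, hy, dite_true]
    have hne : (⟨x, hx⟩ : W) ≠ ⟨y, hy⟩ := fun h => hxy (congrArg Subtype.val h)
    exact hpE (⟨x, hx⟩, h) (⟨y, hy⟩, h') (fun h => hne (Prod.mk.inj h).1) ⟨hne, hExy⟩

/-! ### Blow-ups and the induction on the number of colours. -/

/-- Adjacency in the blow-up of the reflexive relation `Γ` restricted to `W`, where each vertex is
replaced by a clique indexed by `τ`. -/
def BlowupAdj {V τ : Type*} (Γ : V → V → Prop) (W : Finset V) (x y : V × τ) : Prop :=
  x.1 ∈ W ∧ y.1 ∈ W ∧ x ≠ y ∧ Γ x.1 y.1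

theorem BlowupAdj.symm {V τ : Type*} {Γ : V → V → Prop} (hΓ : ∀ x y, Γ x y → Γ y x) {W : Finset V}
    {x y : V × τ} (h : BlowupAdj Γ W x y) : BlowupAdj Γ W y x :=
  ⟨h.2.1, h.1, h.2.2.1.symm, hΓ _ _ h.2.2.2⟩

/-- In a coloured blow-up with large parts, a positive proportion of the parts contain large
monochromatic cliques of a common colour. -/
theorem exists_monochromatic_parts (s M : ℕ) (hs : 0 < s) :
    ∃ T : ℕ, ∀ {V κ : Type} [Fintype V] (Γ : V → V → Prop) (W : Finset V)
      (χ : V × Fin T → V × Fin T → κ) (C : Finset κ), (∀ x, Γ x x) → (∀ x y, χ x y = χ y x) →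
      #C = s → (∀ x y, BlowupAdj Γ W x y → χ x y ∈ C) →
      ∃ c ∈ C, ∃ U ⊆ W, #W ≤ s * #U ∧ ∃ S : V → Finset (V × Fin T),
        (∀ v, ∀ x ∈ S v, x.1 = v) ∧ (∀ v ∈ U, #(S v) = M) ∧
        ∀ v, ∀ x ∈ S v, ∀ y ∈ S v, x ≠ y → BlowupAdj Γ W x y ∧ χ x y = c := by
  obtain ⟨T, hT⟩ := exists_monochromatic_of_sum_le s (s * M)
  refine ⟨T, fun {V κ} _ Γ W χ C hΓ hχ hC hcol => ?_⟩
  have hpart : ∀ v : V, ∃ (c : κ) (S : Finset (V × Fin T)), v ∈ W → c ∈ C ∧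
      (∀ x ∈ S, x.1 = v) ∧ #S = M ∧ ∀ x ∈ S, ∀ y ∈ S, x ≠ y → χ x y = c := by
    intro v
    obtain ⟨c₀, -⟩ : C.Nonempty := card_pos.1 (by omega)
    by_cases hv : v ∈ W
    · obtain ⟨c, hc, S, hS, hSM, hSc⟩ := hT C (fun _ => M) hC (by simp [hC])
        (univ.image fun i => (v, i)) χ hχ (fun x hx y hy hxy => by
          obtain ⟨i, -, rfl⟩ := mem_image.1 hx
          obtain ⟨j, -, rfl⟩ := mem_image.1 hy
          exact hcol _ _ ⟨hv, hv, hxy, hΓ v⟩)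
        (by rw [card_image_of_injective _ fun i j h => (Prod.mk.inj h).2]; simp)
      refine ⟨c, S, fun _ => ⟨hc, fun x hx => ?_, hSM, hSc⟩⟩
      obtain ⟨i, -, rfl⟩ := mem_image.1 (hS hx)
      rfl
    · exact ⟨c₀, ∅, fun h => absurd h hv⟩
  choose col S hS using hpart
  obtain ⟨c, hc, hcW⟩ : ∃ c ∈ C, #W ≤ s * #{v ∈ W | col v = c} := by
    by_contra! h
    have h1 := card_eq_sum_card_fiberwise (f := col) (s := W) (t := C) fun v hv => (hS v hv).1
    have h2 : ∑ c ∈ C, s * #{v ∈ W | col v = c} < ∑ c ∈ C, #W :=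
      sum_lt_sum_of_nonempty (card_pos.1 (by omega)) h
    rw [← mul_sum, ← h1, sum_const, hC, smul_eq_mul] at h2
    exact lt_irrefl _ h2
  refine ⟨c, hc, {v ∈ W | col v = c}, filter_subset _ _, hcW,
    fun v => if v ∈ W ∧ col v = c then S v else ∅, ?_, ?_, ?_⟩
  · intro v x hx
    dsimp only at hx
    split_ifs at hx with hv
    · exact (hS v hv.1).2.1 x hx
    · simp at hx
  · intro v hv
    dsimp only
    rw [if_pos (mem_filter.1 hv)]
    exact (hS v (mem_filter.1 hv).1).2.2.1
  · intro v x hx y hy hxy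
    dsimp only at hx hy
    split_ifs at hx hy with hv
    · obtain ⟨-, h1, -, h2⟩ := hS v hv.1
      refine ⟨⟨?_, ?_, hxy, ?_⟩, hv.2 ▸ h2 x hx y hy hxy⟩
      · rw [h1 x hx]; exact hv.1
      · rw [h1 y hy]; exact hv.1
      · rw [h1 x hx, h1 y hy]; exact hΓ v
    · simp at hx

/-- `Γ` has the property that every colouring with `s` colours of its blow-up by cliques of size `T`,
restricted to any half of the vertices, contains a monochromatic `k`-th power of a path on `n`
vertices. -/
def BlowupArrows {V : Type} [Fintype V] (Γ : V → V → Prop) (T s n k : ℕ) : Prop :=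
  ∀ W : Finset V, Fintype.card V ≤ 2 * #W → ∀ {κ : Type} (C : Finset κ)
    (χ : V × Fin T → V × Fin T → κ), (∀ x y, χ x y = χ y x) → #C = s →
    (∀ x y, BlowupAdj Γ W x y → χ x y ∈ C) →
    ∃ c ∈ C, ContainsPathPower n k fun x y => BlowupAdj Γ W x y ∧ χ x y = c

/-- Injectivity of `φ` is needed only on `D`: two distinct positions mean at least two vertices, and
as `0 < k` each of them lies on an edge of `R`, hence in `D`. -/
theorem ContainsPathPower.map {α β : Type*} {n k : ℕ} (hk : 0 < k) {R : α → α → Prop}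
    {R' : β → β → Prop} (φ : α → β) (hR : ∀ x y, R x y → R' (φ x) (φ y)) (D : α → Prop)
    (hD : ∀ x y, R x y → D x ∧ D y) (hφ : ∀ x y, D x → D y → φ x = φ y → x = y)
    (h : ContainsPathPower n k R) : ContainsPathPower n k R' := by
  obtain ⟨f, hf, hadj⟩ := h
  have hlt : ∀ i j, i < j → j < n → φ (f i) ≠ φ (f j) := by
    intro i j hij hj heq
    have h1 := (hD _ _ (hadj i (i + 1) (by omega) (by omega) (by omega))).1
    have h2 := (hD _ _ (hadj (j - 1) j (by omega) hj (by omega))).2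
    have := hf i (by omega) j hj (hφ _ _ h1 h2 heq)
    omega
  refine ⟨φ ∘ f, fun i hi j hj heq => ?_, fun i j hij hj hle => hR _ _ (hadj i j hij hj hle)⟩
  rcases lt_trichotomy i j with h | h | h
  · exact absurd heq (hlt i j h hj)
  · exact h
  · exact absurd heq.symm (hlt j i h hi)

theorem card_comp_le {V : Type*} [Fintype V] (G Γ : V → V → Prop) (d d' : ℕ)
    (hout : ∀ x, #{y | G x y} ≤ d) (hin : ∀ y, #{x | G x y} ≤ d) (hΓ : ∀ x, #{y | Γ x y} ≤ d')
    (x : V) : #{y | ∃ w w', G w x ∧ Γ w w' ∧ G w' y} ≤ d * d' * d := by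
  have h1 : ({y | ∃ w w', G w x ∧ Γ w w' ∧ G w' y} : Finset V) ⊆
      ((({w | G w x} : Finset V).biUnion fun w => {w' | Γ w w'}).biUnion fun w' => {y | G w' y}) := by
    intro y hy
    obtain ⟨w, w', h1, h2, h3⟩ := (mem_filter.1 hy).2
    simp only [mem_biUnion, mem_filter, mem_univ, true_and]
    exact ⟨w', ⟨w, h1, h2⟩, h3⟩
  refine (card_le_card h1).trans ((card_biUnion_le_card_mul _ _ d fun w' _ => hout w').trans ?_)
  exact Nat.mul_le_mul_right _ ((card_biUnion_le_card_mul _ _ d' fun w _ => hΓ w).trans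
    (Nat.mul_le_mul_right _ (hin x)))

/-- One step of the induction on the number of colours, for a fixed colour `c` in which large
cliques have already been found inside the parts. -/
theorem exists_colour_reducing_map {V τ κ : Type} [Fintype V] (n k d d' T' D K : ℕ) (hk : 0 < k)
    (hd : 0 < d)
    (G Γ' Γ : V → V → Prop) (a : V → Fin d') (ha : ∀ x y, x ≠ y → Γ' x y → a x ≠ a y)
    (hin : ∀ y, #{x | G x y} ≤ d)
    (hG : ∀ X : Finset V, Fintype.card V ≤ K * #X → K * #{w | ∀ x ∈ X, ¬ G w x} < Fintype.card V)
    (hΓ : ∀ x y w w', G w x → Γ' w w' → G w' y → Γ x y)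
    (hsymm : ∀ x y, Γ x y → Γ y x) (hdeg : ∀ x, #{y | Γ x y} ≤ D)
    (W U : Finset V) (hUW : U ⊆ W) (χ : V × τ → V × τ → κ) (hχ : ∀ x y, χ x y = χ y x) (c : κ)
    (S : V → Finset (V × τ)) (hSfst : ∀ v, ∀ x ∈ S v, x.1 = v)
    (hScard : ∀ v ∈ U, #(S v) =
      d * ((2 * (2 * k) + D * d * (2 * k) + 1) * (2 * (2 * k)) ^ (D * d)))
    (hSmono : ∀ v, ∀ x ∈ S v, ∀ y ∈ S v, x ≠ y → BlowupAdj Γ W x y ∧ χ x y = c)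
    (t : ℕ) (ht : Fintype.card V ≤ K * t) (hK : 2 * (d' * T') ≤ K)
    (hU : d' * T' * (t + (n + 2)) ≤ #U) (hUne : U.Nonempty) :
    (ContainsPathPower n k fun x y => BlowupAdj Γ W x y ∧ χ x y = c) ∨
    ∃ (W' : Finset V) (φ : V × Fin T' → V × τ), Fintype.card V ≤ 2 * #W' ∧
      (∀ x y, x.1 ∈ W' → y.1 ∈ W' → φ x = φ y → x = y) ∧
      ∀ x y, BlowupAdj Γ' W' x y → BlowupAdj Γ W (φ x) (φ y) ∧ χ (φ x) (φ y) ≠ c := by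
  set red : V × τ → V × τ → Prop := fun x y => BlowupAdj Γ W x y ∧ χ x y = c with hred_def
  have hred : ∀ x y, red x y → red y x := fun x y h => ⟨h.1.symm hsymm, (hχ y x).trans h.2⟩
  have hSdisj : ∀ u v, u ≠ v → Disjoint (S u) (S v) := fun u v huv => disjoint_left.2
    fun x hx hx' => huv ((hSfst u x hx).symm.trans (hSfst v x hx'))
  let R : V → V → Prop := fun u v => ∃ A ⊆ S u, ∃ D ⊆ S v, #A = 2 * k ∧ #D = 2 * k ∧
    ∀ a ∈ A, ∀ b ∈ D, red a b
  have hRsymm : ∀ u v, R u v → R v u := by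
    rintro u v ⟨A, hA, D, hD, hAc, hDc, h⟩
    exact ⟨D, hD, A, hA, hDc, hAc, fun a ha b hb => hred _ _ (h b hb a ha)⟩
  by_cases hpath : ∃ P : List V, P.Nodup ∧ P.IsChain R ∧ n + 2 ≤ P.length
  · obtain ⟨P, hnd, hch, hlen⟩ := hpath
    exact Or.inl (containsPathPower_of_chain n k hk red S hSdisj hSmono P hnd hch hlen)
  right
  push Not at hpath
  -- One family `X (q, j)` for each colour `q` of the proper colouring `a` and each copy `j` in a
  -- part of the blow-up of `Γ'`.
  obtain ⟨X, hX, hXX⟩ := exists_separated_family (ι := Fin d' × Fin T') R hRsymm (n + 2) t U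
    (fun P h1 h2 _ => hpath P h1 h2) (by simpa using hU)
  obtain ⟨u₀, hu₀⟩ := hUne
  have hne : Nonempty (V × τ) := by
    obtain ⟨x, -⟩ := card_pos.1 ((hScard u₀ hu₀).symm ▸ (by positivity) : 0 < #(S u₀))
    exact ⟨x⟩
  obtain ⟨p, hpS, hpinj, hpred⟩ := exists_transversal_slots
    (fun x y => Γ x y ∧ ¬ R x y) (fun x y h => ⟨hsymm _ _ h.1, fun h' => h.2 (hRsymm _ _ h')⟩)
    D d (2 * k) (by omega)
    (fun x => (card_le_card fun y => by simp +contextual).trans (hdeg x)) red hred U S hScard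
    (fun x _ y _ _ hxy => hxy.2)
  -- Up to `d` points `w` may choose the same out-neighbour `y`; the slots give them different
  -- representatives in `S y`.
  choose slot hslot using fun y => exists_injOn_fin d hd {x | G x y} (hin y)
  let W' : Finset V := {w | ∀ i, ∃ x ∈ X i, G w x}
  have hW' : ∀ w, ∃ x : Fin d' × Fin T' → V, w ∈ W' → ∀ i, x i ∈ X i ∧ G w (x i) := by
    intro w
    by_cases hw : w ∈ W'
    · choose x hx using (mem_filter.1 hw).2
      exact ⟨x, fun _ => hx⟩
    · exact ⟨fun _ => w, fun h => absurd h hw⟩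
  choose x hx using hW'
  have hXdisj : ∀ i j v, v ∈ X i → v ∈ X j → i = j := fun i j v hi hj => by
    by_contra hij
    exact disjoint_left.1 (hXX i j hij).1 hi hj
  refine ⟨W', fun q => p (x q.1 (a q.1, q.2)) (slot (x q.1 (a q.1, q.2)) q.1), ?_, ?_, ?_⟩
  -- Each of the `d' * T'` families is missed by fewer than `card V / K` points, so `2 * (d' * T') ≤
  -- K` keeps at least half.
  · have h1 : W'ᶜ ⊆ univ.biUnion fun i => {w | ∀ x ∈ X i, ¬ G w x} := by
      intro w hw
      simpa [W'] using hw
    have h2 := (card_le_card h1).trans card_biUnion_le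
    have h3 : K * ∑ i, #{w | ∀ x ∈ X i, ¬ G w x} ≤ d' * T' * Fintype.card V := by
      rw [mul_sum]
      refine (sum_le_card_nsmul _ _ _ fun i _ => (hG (X i) ?_).le).trans (by simp)
      rw [(hX i).2]
      exact ht
    have h4 := card_add_card_compl W'
    by_contra! h5
    have h6 : K * #W'ᶜ ≤ d' * T' * Fintype.card V := (Nat.mul_le_mul_left K h2).trans h3
    have h7 : 0 < K := by
      by_contra h
      have : K = 0 := by omega
      subst this
      simp only [zero_mul, Nat.le_zero] at ht
      exact (Fintype.card_pos_iff.2 ⟨u₀⟩).ne' ht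
    have h8 : Fintype.card V < 2 * #W'ᶜ := by omega
    have h9 : K * Fintype.card V < K * (2 * #W'ᶜ) := Nat.mul_lt_mul_of_pos_left h8 h7
    have h10 := Nat.mul_le_mul_right (Fintype.card V) hK
    linarith
  · rintro ⟨w, j⟩ ⟨w', j'⟩ hw hw' heq
    dsimp only at hw hw' heq
    have h1 := hx w hw (a w, j)
    have h2 := hx w' hw' (a w', j')
    have hxx : x w (a w, j) = x w' (a w', j') := by
      rw [← hSfst _ _ (hpS _ ((hX _).1 h1.1) (slot (x w (a w, j)) w)), heq,
        hSfst _ _ (hpS _ ((hX _).1 h2.1) (slot (x w' (a w', j')) w'))]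
    have hij := hXdisj _ _ _ h1.1 (hxx ▸ h2.1)
    rw [hxx] at heq
    have hs := hpinj _ ((hX _).1 h2.1) heq
    have hww := hslot _ w (by simpa [← hxx] using h1.2) w' (by simpa using h2.2) hs
    rw [hww, (Prod.mk.inj hij).2]
  · rintro ⟨w, j⟩ ⟨w', j'⟩ ⟨hw, hw', hne', hww⟩
    dsimp only at hw hw' hww ⊢
    have h1 := hx w hw (a w, j)
    have h2 := hx w' hw' (a w', j')
    -- Copies of one point differ in `j`; distinct `Γ'`-related points differ in `a`. The images
    -- therefore come from different, unlinked families.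
    have hij : (a w, j) ≠ (a w', j') := by
      intro h
      obtain ⟨h3, h4⟩ := Prod.mk.inj h
      by_cases hwe : w = w'
      · exact hne' (by rw [hwe, h4])
      · exact ha w w' hwe hww h3
    have hU1 := (hX _).1 h1.1
    have hU2 := (hX _).1 h2.1
    have hxy : x w (a w, j) ≠ x w' (a w', j') := fun h =>
      hij (hXdisj _ _ _ h1.1 (h ▸ h2.1))
    have hfst1 := hSfst _ _ (hpS _ hU1 (slot (x w (a w, j)) w))
    have hfst2 := hSfst _ _ (hpS _ hU2 (slot (x w' (a w', j')) w'))
    have hΓxy := hΓ _ _ _ _ h1.2 hww h2.2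
    have hadj : BlowupAdj Γ W (p (x w (a w, j)) (slot (x w (a w, j)) w))
        (p (x w' (a w', j')) (slot (x w' (a w', j')) w')) := by
      refine ⟨by rw [hfst1]; exact hUW hU1, by rw [hfst2]; exact hUW hU2, fun h => hxy ?_,
        by rw [hfst1, hfst2]; exact hΓxy⟩
      rw [← hfst1, h, hfst2]
    exact ⟨hadj, fun hc => hpred _ hU1 _ hU2 hxy
      ⟨hΓxy, (hXX _ _ hij).2 _ h1.1 _ h2.1⟩ _ _ ⟨hadj, hc⟩⟩

/-- For every number `s` of colours there are bounded-degree relations on linearly many vertices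
whose bounded blow-ups are Ramsey for path powers. -/
theorem exists_blowupArrows (k s : ℕ) (hk : 0 < k) :
    ∃ d T A : ℕ, ∀ n, 0 < n → ∀ N, A * n ≤ N → ∃ Γ : Fin N → Fin N → Prop,
      (∀ x, Γ x x) ∧ (∀ x y, Γ x y → Γ y x) ∧ (∀ x, #{y | Γ x y} ≤ d) ∧
      BlowupArrows Γ T s n k := by
  induction s with
  | zero =>
    -- Without colours no edge may exist, but parts of size two already contain one.
    refine ⟨1, 2, 1, fun n hn N hN => ⟨Eq, fun _ => rfl, fun _ _ => Eq.symm,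
      fun x => ?_, ?_⟩⟩
    · rw [card_le_one]
      intro a ha b hb
      exact (by simpa using ha : x = a).symm.trans (by simpa using hb)
    · intro W hW κ C χ hχ hC hcol
      rw [Fintype.card_fin] at hW
      obtain ⟨w, hw⟩ := card_pos.1 (by omega : 0 < #W)
      have := hcol (w, 0) (w, 1) ⟨hw, hw, by simp, rfl⟩
      rw [card_eq_zero.1 hC] at this
      simp at this
  | succ s ih =>
    obtain ⟨d', T', A', hΓ'⟩ := ih
    set l := d' * T' with hl
    -- Since `#U` is at least `N / (2 * (s + 1))`, this gives `4 * (l + 1) * (N / K) ≤ #U`, enough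
    -- for `l` families of size `N / K + 1` and the paths lost in the search.
    set K := 8 * (l + 1) * (s + 1) with hK
    have hKpos : 0 < K := by positivity
    obtain ⟨d, hexp⟩ := exists_bounded_degree_expander K hKpos
    set D := d * d' * d with hD
    obtain ⟨T, hT⟩ := exists_monochromatic_parts (s + 1)
      (d * ((2 * (2 * k) + D * d * (2 * k) + 1) * (2 * (2 * k)) ^ (D * d))) (by omega)
    -- The term `A'` feeds the induction hypothesis; `3 * K` gives `3 * n ≤ N / K`, which absorbs
    -- `n` and the additive constants.
    refine ⟨D, T, A' + 3 * K, fun n hn N hN => ?_⟩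
    rw [add_mul] at hN
    obtain ⟨Γ', hrefl', hsymm', hdeg', harr⟩ := hΓ' n hn N (by omega)
    have hN3 : 3 * n * K ≤ N := by
      have : 3 * n * K = 3 * K * n := by ring
      omega
    have hNpos : 0 < N := by
      have : 0 < 3 * n * K := by positivity
      omega
    obtain ⟨G, hGrefl, hGout, hGin, hG⟩ := hexp N hNpos
    obtain ⟨a, ha⟩ := exists_proper_colouring Γ' d' hrefl' hsymm' hdeg'
    have hdpos : 0 < d := (card_pos.2 ⟨⟨0, hNpos⟩, by simpa using hGrefl _⟩).trans_le
      (hGout ⟨0, hNpos⟩)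
    obtain ⟨Γ, hΓ⟩ : ∃ Γ : Fin N → Fin N → Prop,
        ∀ x y, Γ x y ↔ ∃ w w', G w x ∧ Γ' w w' ∧ G w' y := ⟨_, fun _ _ => Iff.rfl⟩
    have hrefl : ∀ x, Γ x x := fun x => (hΓ x x).2 ⟨x, x, hGrefl x, hrefl' x, hGrefl x⟩
    have hsymm : ∀ x y, Γ x y → Γ y x := fun x y h => by
      obtain ⟨w, w', h1, h2, h3⟩ := (hΓ x y).1 h
      exact (hΓ y x).2 ⟨w', w, h3, hsymm' _ _ h2, h1⟩
    have hdeg : ∀ x, #{y | Γ x y} ≤ D := fun x => by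
      simp only [hΓ]
      convert card_comp_le G Γ' d d' hGout hGin hdeg' x
    refine ⟨Γ, hrefl, hsymm, hdeg, ?_⟩
    intro W hW κ C χ hχ hC hcol
    rw [Fintype.card_fin] at hW
    obtain ⟨c, hc, U, hUW, hUcard, S, hSfst, hScard, hSmono⟩ := hT Γ W χ C hrefl hχ hC hcol
    have hq : 3 * n ≤ N / K := (Nat.le_div_iff_mul_le hKpos).2 hN3
    have hU4 : 4 * (l + 1) * (N / K) ≤ #U := by
      have h1 : N / K * K ≤ N := Nat.div_mul_le_self N K
      refine Nat.le_of_mul_le_mul_left (c := 2 * (s + 1)) ?_ (by omega)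
      calc 2 * (s + 1) * (4 * (l + 1) * (N / K)) = N / K * K := by rw [hK]; ring
        _ ≤ N := h1
        _ ≤ 2 * #W := hW
        _ ≤ 2 * ((s + 1) * #U) := Nat.mul_le_mul_left _ hUcard
        _ = _ := by ring
    have hUne : U.Nonempty := by
      refine card_pos.1 (lt_of_lt_of_le ?_ hU4)
      have : 0 < N / K := by omega
      positivity
    have hcases := exists_colour_reducing_map n k d d' T' D K hk hdpos G Γ' Γ a ha hGin
      (fun X hX => by
        rw [Fintype.card_fin] at hX ⊢
        convert hG X hX) (fun x y w w' h1 h2 h3 => (hΓ x y).2 ⟨w, w', h1, h2, h3⟩)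
      hsymm hdeg W U hUW χ hχ c S hSfst hScard hSmono (N / K + 1)
      (by
        rw [Fintype.card_fin, mul_add, mul_one]
        exact (Nat.lt_mul_div_succ N hKpos).le)
      (by
        rw [← hl, hK]
        nlinarith [Nat.zero_le (l * s)])
      (by
        refine le_trans ?_ hU4
        rw [← hl]
        calc l * (N / K + 1 + (n + 2)) ≤ l * (4 * (N / K)) := Nat.mul_le_mul_left _ (by omega)
          _ ≤ (l + 1) * (4 * (N / K)) := Nat.mul_le_mul_right _ (by omega)
          _ = _ := by ring) hUne
    rcases hcases with h | ⟨W', φ, hW', hφinj, hφ⟩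
    · exact ⟨c, hc, h⟩
    -- The colouring pulled back along `φ` never uses `c` on the smaller blow-up.
    · obtain ⟨c', hc', hpath⟩ := harr W' hW' (C.erase c) (fun x y => χ (φ x) (φ y))
        (fun x y => hχ _ _) (by rw [card_erase_of_mem hc, hC]; rfl)
        (fun x y hxy => mem_erase.2 ⟨(hφ x y hxy).2, hcol _ _ (hφ x y hxy).1⟩)
      exact ⟨c', mem_of_mem_erase hc', hpath.map hk φ (fun x y h => ⟨(hφ x y h.1).1, h.2⟩)
        (fun x => x.1 ∈ W') (fun x y h => ⟨h.1.1, h.1.2.1⟩) hφinj⟩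

/-! ### Translation to simple graphs and the edge count. -/

theorem le_add_of_walk_pathGraph {n : ℕ} {i j : Fin n} (w : (SimpleGraph.pathGraph n).Walk i j) :
    (j : ℕ) ≤ i + w.length := by
  induction w with
  | nil => simp
  | cons h w ih =>
    rw [SimpleGraph.pathGraph_adj] at h
    rw [SimpleGraph.Walk.length_cons]
    omega

theorem pathPower_adj_le {n k : ℕ} {i j : Fin n} (h : (pathPower n k).Adj i j) :
    (j : ℕ) ≤ i + k := by
  have hle : (SimpleGraph.pathGraph n).edist i j ≤ k := h.2
  obtain ⟨w, hw⟩ := SimpleGraph.exists_walk_of_edist_ne_top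
    (ne_top_of_le_ne_top (ENat.natCast_ne_top k) hle)
  rw [← hw, Nat.cast_le] at hle
  exact (le_add_of_walk_pathGraph w).trans (by omega)

theorem ContainsPathPower.isContained {V : Type*} {n k : ℕ} {G : SimpleGraph V}
    (h : ContainsPathPower n k G.Adj) : (pathPower n k).IsContained G := by
  obtain ⟨f, hf, hadj⟩ := h
  refine ⟨⟨⟨fun i => f i, fun {i j} hij => ?_⟩, fun i j hij => ?_⟩⟩
  · rcases lt_or_gt_of_ne (Fin.val_ne_of_ne hij.ne) with h | h
    · exact hadj _ _ h j.2 (pathPower_adj_le hij)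
    · exact (hadj _ _ h i.2 (pathPower_adj_le hij.symm)).symm
  · exact Fin.ext (hf _ i.2 _ j.2 hij)

/-- The blow-up of a symmetric relation by cliques, on the vertex set `Fin (N * T)`. -/
def blowup {N : ℕ} (T : ℕ) (Γ : Fin N → Fin N → Prop) (hΓ : ∀ x y, Γ x y → Γ y x) :
    SimpleGraph (Fin (N * T)) where
  Adj x y := BlowupAdj Γ univ (finProdFinEquiv.symm x) (finProdFinEquiv.symm y)
  symm := ⟨fun _ _ h => h.symm hΓ⟩
  loopless := ⟨fun _ h => h.2.2.1 rfl⟩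

theorem ncard_edgeSet_blowup_le {N T d : ℕ} (Γ : Fin N → Fin N → Prop)
    (hΓ : ∀ x y, Γ x y → Γ y x) (hd : ∀ x, #{y | Γ x y} ≤ d) :
    (blowup T Γ hΓ).edgeSet.ncard ≤ N * T * (d * T) := by
  have hdeg : ∀ x, (blowup T Γ hΓ).degree x ≤ d * T := by
    intro x
    rw [← SimpleGraph.card_neighborFinset_eq_degree]
    have h1 : (blowup T Γ hΓ).neighborFinset x ⊆
        (({y | Γ (finProdFinEquiv.symm x).1 y} : Finset (Fin N)) ×ˢ
          (univ : Finset (Fin T))).image finProdFinEquiv := by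
      intro y hy
      rw [SimpleGraph.mem_neighborFinset] at hy
      refine mem_image.2 ⟨finProdFinEquiv.symm y, ?_, Equiv.apply_symm_apply _ _⟩
      simpa using hy.2.2.2
    refine (card_le_card h1).trans (card_image_le.trans ?_)
    rw [card_product, card_univ, Fintype.card_fin]
    exact Nat.mul_le_mul_right _ (hd _)
  have hsum := (blowup T Γ hΓ).sum_degrees_eq_twice_card_edges
  have hle := sum_le_card_nsmul univ _ _ fun x _ => hdeg x
  rw [hsum, card_univ, Fintype.card_fin, smul_eq_mul] at hle
  rw [← SimpleGraph.coe_edgeFinset, Set.ncard_coe_finset]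
  omega

theorem BlowupArrows.arrows {N T s n k : ℕ} (hs : 0 < s) {Γ : Fin N → Fin N → Prop}
    (hΓ : ∀ x y, Γ x y → Γ y x) (h : BlowupArrows Γ T s n k) :
    Arrows (blowup T Γ hΓ) (pathPower n k) s := by
  intro χ
  let col : Fin N × Fin T → Fin N × Fin T → Fin s := fun x y =>
    -- The colour `0` on non-edges is a dummy value, never seen by the path power found.
    if h : (blowup T Γ hΓ).Adj (finProdFinEquiv x) (finProdFinEquiv y) then χ.get _ _ h else ⟨0, hs⟩
  have hcol : ∀ x y, col x y = col y x := by
    intro x y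
    by_cases hxy : (blowup T Γ hΓ).Adj (finProdFinEquiv x) (finProdFinEquiv y)
    · simp only [col, hxy, hxy.symm, dite_true]
      exact χ.get_comm _ _ _
    · have hyx : ¬ (blowup T Γ hΓ).Adj (finProdFinEquiv y) (finProdFinEquiv x) :=
        fun h => hxy h.symm
      simp only [col, hxy, hyx, dite_false]
  obtain ⟨c, -, f, hf, hadj⟩ := h univ (by simp [card_univ]; omega) univ col hcol (by simp)
    (fun _ _ _ => mem_univ _)
  refine ⟨c, ContainsPathPower.isContained ⟨fun i => finProdFinEquiv (f i), fun i hi j hj hij =>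
    hf i hi j hj (finProdFinEquiv.injective hij), fun i j hij hj hle => ?_⟩⟩
  obtain ⟨h1, h2⟩ := hadj i j hij hj hle
  have h3 : (blowup T Γ hΓ).Adj (finProdFinEquiv (f i)) (finProdFinEquiv (f j)) := by
    simpa only [blowup, Equiv.symm_apply_apply] using h1
  rw [SimpleGraph.EdgeLabeling.labelGraph_adj]
  refine ⟨h3, ?_⟩
  exact (χ.get_eq _ _ h3).symm.trans (by simpa only [col, h3, dite_true] using h2)

/-- Taking `A * n` points gives `A * n * T` vertices of degree at most `d * T`, with `d`, `T` and
`A` independent of `n`. -/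
theorem exists_linear_size_arrows (s k : ℕ) (hs : 0 < s) (hk : 0 < k) :
    ∃ C : ℕ, ∀ n : ℕ, 1 ≤ n → ∃ (N : ℕ) (G : SimpleGraph (Fin N)),
      G.edgeSet.ncard ≤ C * n ∧ Arrows G (pathPower n k) s := by
  obtain ⟨d, T, A, h⟩ := exists_blowupArrows k s hk
  refine ⟨A * T * (d * T), fun n hn => ?_⟩
  obtain ⟨Γ, -, hsymm, hdeg, harr⟩ := h n hn (A * n) le_rfl
  refine ⟨_, blowup T Γ hsymm, (ncard_edgeSet_blowup_le Γ hsymm hdeg).trans_eq (by ring),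
    harr.arrows hs hsymm⟩

end SizeRamsey

theorem theorem1p2 (s k : ℕ) (hs : 1 ≤ s) (hk : 1 ≤ k) :
    ((fun n : ℕ => (SizeRamsey.sizeRamseyNumber s (SizeRamsey.pathPower n k) : ℝ))
        =O[Filter.atTop] (fun n : ℕ => (n : ℝ))) ∧
    (∃ C : ℕ, ∀ n : ℕ, 1 ≤ n → ∃ (N : ℕ) (G : SimpleGraph (Fin N)),
        G.edgeSet.ncard ≤ C * n ∧ SizeRamsey.Arrows G (SizeRamsey.pathPower n k) s) := by
  obtain ⟨C, hC⟩ := SizeRamsey.exists_linear_size_arrows s k hs hk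
  refine ⟨Asymptotics.IsBigO.of_bound C ?_, C, hC⟩
  filter_upwards [Filter.eventually_ge_atTop 1] with n hn
  obtain ⟨N, G, hG, harr⟩ := hC n hn
  have hle : SizeRamsey.sizeRamseyNumber s (SizeRamsey.pathPower n k) ≤ C * n :=
    le_trans (Nat.sInf_le ⟨N, G, harr, rfl⟩) hG
  simp only [Real.norm_natCast]
  exact_mod_cast hle
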